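/- Let $n\le m$ be natural numbers, let $\mathbb M_{m,n}$ be the Euclidean space of real $m\times n$ matrices, and let $\sigma(X)=(\sigma_1(X),\dots,\sigma_n(X))\in\mathbb R^n$ be the vector of singular values of $X\in\mathbb M_{m,n}$ in nonincreasing order. For a subset $C$ of a Euclidean space and a point $x$, let $$T_C(x)=\{w : \exists\, t_k\downarrow 0,\ w_k\to w \text{ with } x+t_kw_k\in C \text{ for all } k\}$$ be the tangent cone, where $t_k\downarrow0$ means $t_k>0$ and $t_k\to0$. Let $\Gamma\subset\mathbb M_{m,n}$ be an orthogonally invariant set, i.e. $U^TXV\in\Gamma\iff X\in\Gamma$ for all $X\in\mathbb M_{m,n}$ and all orthogonal matrices $U\in\mathbb R^{m\times m}$, $V\in\mathbb R^{n\times n}$, represented as $$\Gamma=\{X\in\mathbb M_{m,n} : \sigma(X)\in\Delta\},$$ where $\Delta\subset\mathbb R^n$ is absolutely symmetric, i.e. $Qx\in\Delta\iff x\in\Delta$ for all $x\in\mathbb R^n$ and all $n\times n$ signed permutation matrices $Q$ (matrices with entries in $\{0,1,-1\}$ having exactly one nonzero entry in each row and each column). Then, for every $X\in\Gamma$, the directional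 derivative $$\sigma'(X;H)=\lim_{t\downarrow0}\frac{\sigma(X+tH)-\sigma(X)}{t}$$ exists for every $H\in\mathbb M_{m,n}$, and $$T_\Gamma(X)=\{H\in\mathbb M_{m,n} : \sigma'(X;H)\in T_\Delta(\sigma(X))\}.$$ -/

import Mathlib

open Filter Topology

/-- The tangent cone to `C` at `x`: all limits `w` of sequences `w_k` for which there are
`t_k > 0` with `t_k → 0` and `x + t_k w_k ∈ C` for all `k`. -/
def bouligandTangentCone {E : Type*} [AddCommGroup E] [Module ℝ E] [TopologicalSpace E]
    (C : Set E) (x : E) : Set E :=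
  {w | ∃ (t : ℕ → ℝ) (v : ℕ → E), (∀ k, 0 < t k) ∧ Tendsto t atTop (𝓝 0) ∧
    Tendsto v atTop (𝓝 w) ∧ ∀ k, x + t k • v k ∈ C}

/-- `d` is the (one-sided) directional derivative of `g` at `x` in the direction `w`, that is,
`d = lim_{t ↓ 0} (g (x + t w) - g x) / t`. -/
def HasDirectionalDeriv {E F : Type*} [AddCommGroup E] [Module ℝ E]
    [AddCommGroup F] [Module ℝ F] [TopologicalSpace F] (g : E → F) (x w : E) (d : F) : Prop :=
  Tendsto (fun t : ℝ => t⁻¹ • (g (x + t • w) - g x)) (𝓝[>] 0) (𝓝 d)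

/-- The directional derivative `g'(x; w) = lim_{t ↓ 0} (g (x + t w) - g x) / t`
(meaningful only when this limit exists). -/
noncomputable def directionalDeriv {E F : Type*} [AddCommGroup E] [Module ℝ E]
    [AddCommGroup F] [Module ℝ F] [TopologicalSpace F] (g : E → F) (x w : E) : F :=
  limUnder (𝓝[>] (0 : ℝ)) (fun t : ℝ => t⁻¹ • (g (x + t • w) - g x))

/-- The vector `(σ₁(X), …, σₙ(X))` of singular values of the `m × n` matrix `X`, in nonincreasing
order and repeated according to multiplicity: the square roots of the eigenvalues of `Xᵀ X`. -/
noncomputable def singularValueVector {m n : ℕ} (X : Matrix (Fin m) (Fin n) ℝ) :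
    EuclideanSpace ℝ (Fin n) :=
  WithLp.toLp 2 (fun i : Fin n => (Matrix.toEuclideanLin X).singularValues i)

/-- Signed permutation matrices: all entries are `0` or `±1`, and each row and each column has
exactly one nonzero entry. -/
def IsSignedPermutationMatrix {n : ℕ} (Q : Matrix (Fin n) (Fin n) ℝ) : Prop :=
  (∀ i j, Q i j = 0 ∨ Q i j = 1 ∨ Q i j = -1) ∧
    (∀ i, ∃! j, Q i j ≠ 0) ∧ (∀ j, ∃! i, Q i j ≠ 0)

/-- A set `Δ ⊆ ℝⁿ` is absolutely symmetric if its indicator function is invariant under all signed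
permutation matrices. -/
def IsAbsolutelySymmetricSet {n : ℕ} (Δ : Set (EuclideanSpace ℝ (Fin n))) : Prop :=
  ∀ Q : Matrix (Fin n) (Fin n) ℝ, IsSignedPermutationMatrix Q →
    ∀ x : EuclideanSpace ℝ (Fin n), Matrix.toEuclideanLin Q x ∈ Δ ↔ x ∈ Δ

/-- A set `Γ` of `m × n` matrices is orthogonally invariant if its indicator function is invariant
under `X ↦ Uᵀ X V` for all orthogonal `U`, `V`. -/
def IsOrthogonallyInvariantSet {m n : ℕ} (Γ : Set (Matrix (Fin m) (Fin n) ℝ)) : Prop :=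
  ∀ U ∈ Matrix.orthogonalGroup (Fin m) ℝ, ∀ V ∈ Matrix.orthogonalGroup (Fin n) ℝ,
    ∀ X : Matrix (Fin m) (Fin n) ℝ, U.transpose * X * V ∈ Γ ↔ X ∈ Γ

/-! Two facts carry the proof. First, the singular values have directional derivatives in the sense
of Hadamard, with directions allowed to vary. By Ky Fan's inequality the sum of the k largest is a
maximum of linear functions of the matrix, hence convex and locally Lipschitz, and each singular
value is a difference of two such sums. Along a sequence tangent to `Γ` at `X`, the difference
quotients of the singular values therefore converge to the derivative, which gives one inclusion.

Second, tangent vectors of `Δ` lift. Given `σ(X) + t_k v_k ∈ Δ` with `v_k → σ'(X; H)`, keep the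
singular frames of `X + t_k H` and replace its diagonal by `σ(X) + t_k v_k`. The new matrix lies in
`Γ` by absolute symmetry of `Δ`. The diagonals differ by `o(t_k)`, hence so do the matrices,
uniformly in the frames: no continuity of singular vectors is needed. -/

open Finset in
/-- A weighted sum with weights in `[0, 1]` of total mass at most `#S` is bounded by the sum over
`S`, if the terms are nonnegative and largest on `S`. -/
lemma sum_mul_le_sum_of_dominating {ι : Type*} [Fintype ι] [DecidableEq ι] {s w : ι → ℝ}
    {S : Finset ι} (hs : ∀ i, 0 ≤ s i) (hS : ∀ i ∈ S, ∀ j ∉ S, s j ≤ s i)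
    (hw0 : ∀ i, 0 ≤ w i) (hw1 : ∀ i, w i ≤ 1) (hw : ∑ i, w i ≤ #S) :
    ∑ i, s i * w i ≤ ∑ i ∈ S, s i := by
  -- A threshold `c` separates the values on `S` from the rest. Subtracting it makes the bound
  -- termwise, and `0 ≤ c` lets the mass bound absorb `c * ∑ w`.
  obtain ⟨c, hc0, hcS, hcS'⟩ : ∃ c : ℝ, 0 ≤ c ∧ (∀ i ∈ S, c ≤ s i) ∧ ∀ j ∉ S, s j ≤ c := by
    rcases Sᶜ.eq_empty_or_nonempty with h | h
    · refine ⟨0, le_rfl, fun i _ => hs i, fun j hj => ?_⟩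
      simp_all
    · obtain ⟨j, hj, hmax⟩ := exists_max_image Sᶜ s h
      exact ⟨s j, hs j, fun i hi => hS i hi j (by simpa using hj),
        fun l hl => hmax l (by simpa using hl)⟩
  have key : ∀ i, (s i - c) * w i ≤ if i ∈ S then s i - c else 0 := by
    intro i
    split_ifs with hi
    · nlinarith [hcS i hi, hw1 i]
    · nlinarith [hcS' i hi, hw0 i]
  have h1 := sum_le_sum fun i (_ : i ∈ univ) => key i
  rw [← sum_filter, filter_mem_eq_inter, univ_inter, sum_sub_distrib, sum_const,
    nsmul_eq_mul] at h1
  simp only [sub_mul, sum_sub_distrib, ← mul_sum] at h1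
  nlinarith

/-! ### Ky Fan's inequality and singular value decompositions -/

section KyFan

variable {E F : Type*} [NormedAddCommGroup E] [InnerProductSpace ℝ E]
  [NormedAddCommGroup F] [InnerProductSpace ℝ F]

open Finset in
lemma Orthonormal.sum_sq_inner_le {ι : Type*} {u : ι → E} (hu : Orthonormal ℝ u) (S : Finset ι)
    {x : E} (hx : ‖x‖ = 1) : ∑ i ∈ S, inner ℝ (u i) x ^ 2 ≤ 1 := by
  simpa [hx] using hu.sum_inner_products_le x (s := S)

open Finset in
lemma Orthonormal.sum_sum_sq_inner_le {ι κ : Type*} [Fintype κ] {u : ι → E} {a : κ → E}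
    (hu : Orthonormal ℝ u) (ha : Orthonormal ℝ a) (S : Finset ι) :
    ∑ j, ∑ i ∈ S, inner ℝ (u i) (a j) ^ 2 ≤ #S := by
  rw [sum_comm]
  calc _ ≤ ∑ i ∈ S, (1 : ℝ) := sum_le_sum fun i _ => by
        simpa only [real_inner_comm] using ha.sum_sq_inner_le univ (hu.1 i)
    _ = #S := by simp

open Finset in
/-- Ky Fan's inequality: if `T (b j) = s j • a j` with `a`, `b` orthonormal, then
`∑ i ∈ S, ⟪u i, T (v i)⟫ ≤ ∑ i ∈ S, s i` for orthonormal `u`, `v` and a set `S` of indices carrying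
the largest of the `s i`. -/
theorem sum_inner_map_le_of_map_eq_smul {n : ℕ} {T : E →ₗ[ℝ] F}
    (b : OrthonormalBasis (Fin n) ℝ E) {a : Fin n → F} (ha : Orthonormal ℝ a) {s : Fin n → ℝ}
    (hs : ∀ i, 0 ≤ s i) (hT : ∀ j, T (b j) = s j • a j) {S : Finset (Fin n)}
    (hS : ∀ i ∈ S, ∀ j ∉ S, s j ≤ s i) {u : Fin n → F} {v : Fin n → E}
    (hu : Orthonormal ℝ u) (hv : Orthonormal ℝ v) :
    ∑ i ∈ S, inner ℝ (u i) (T (v i)) ≤ ∑ i ∈ S, s i := by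
  set p : Fin n → ℝ := fun j => ∑ i ∈ S, inner ℝ (u i) (a j) ^ 2
  set q : Fin n → ℝ := fun j => ∑ i ∈ S, inner ℝ (v i) (b j) ^ 2
  have hp0 : ∀ j, 0 ≤ p j := fun j => sum_nonneg fun i _ => sq_nonneg _
  have hq0 : ∀ j, 0 ≤ q j := fun j => sum_nonneg fun i _ => sq_nonneg _
  have hp1 : ∀ j, p j ≤ 1 := fun j => hu.sum_sq_inner_le S (ha.1 j)
  have hq1 : ∀ j, q j ≤ 1 := fun j => hv.sum_sq_inner_le S (b.orthonormal.1 j)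
  have hp : ∑ j, p j ≤ #S := hu.sum_sum_sq_inner_le ha S
  have hq : ∑ j, q j ≤ #S := hv.sum_sum_sq_inner_le b.orthonormal S
  refine le_trans ?_ (sum_mul_le_sum_of_dominating (w := fun j => (p j + q j) / 2) hs hS
    (fun j => by linarith [hp0 j, hq0 j]) (fun j => by linarith [hp1 j, hq1 j])
    (by rw [← sum_div, sum_add_distrib]; linarith))
  have expand : ∀ i, inner ℝ (u i) (T (v i)) =
      ∑ j, s j * (inner ℝ (u i) (a j) * inner ℝ (v i) (b j)) := by
    intro i
    conv_lhs => rw [← b.sum_repr' (v i)]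
    rw [map_sum, inner_sum]
    refine sum_congr rfl fun j _ => ?_
    rw [map_smul, hT, real_inner_smul_right, real_inner_smul_right, real_inner_comm]
    ring
  simp only [expand]
  rw [sum_comm]
  refine sum_le_sum fun j _ => ?_
  rw [← mul_sum]
  refine mul_le_mul_of_nonneg_left ?_ (hs j)
  simp only [p, q]
  rw [← sum_add_distrib, sum_div]
  refine sum_le_sum fun i _ => ?_
  -- The inequality `xy ≤ (x² + y²) / 2` is the origin of the weights `(p j + q j) / 2`.
  nlinarith [sq_nonneg (inner ℝ (u i) (a j) - inner ℝ (v i) (b j))]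

open Finset in
lemma sum_inner_map_eq_of_map_eq_smul {n : ℕ} {T : E →ₗ[ℝ] F} {b : Fin n → E} {a : Fin n → F}
    (ha : Orthonormal ℝ a) {s : Fin n → ℝ} (hT : ∀ j, T (b j) = s j • a j) (S : Finset (Fin n)) :
    ∑ i ∈ S, inner ℝ (a i) (T (b i)) = ∑ i ∈ S, s i :=
  sum_congr rfl fun i _ => by
    rw [hT, real_inner_smul_right, real_inner_self_eq_norm_sq, ha.1 i]; ring

lemma Antitone.le_of_mem_Iic_of_notMem {n : ℕ} {s : Fin n → ℝ} (hs : Antitone s) (k : Fin n) :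
    ∀ i ∈ Finset.Iic k, ∀ j ∉ Finset.Iic k, s j ≤ s i := by
  intro i hi j hj
  simp only [Finset.mem_Iic, not_le] at hi hj
  exact hs (hi.trans hj.le)

lemma Antitone.le_of_mem_Iio_of_notMem {n : ℕ} {s : Fin n → ℝ} (hs : Antitone s) (k : Fin n) :
    ∀ i ∈ Finset.Iio k, ∀ j ∉ Finset.Iio k, s j ≤ s i := by
  intro i hi j hj
  simp only [Finset.mem_Iio, not_lt] at hi hj
  exact hs (hi.le.trans hj)

/-- Turns statements about sums of largest values into statements about each single value. -/
lemma eq_sum_Iic_sub_sum_Iio {n : ℕ} (s : Fin n → ℝ) (k : Fin n) :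
    s k = ∑ i ∈ Finset.Iic k, s i - ∑ i ∈ Finset.Iio k, s i := by
  rw [← Finset.Iio_insert, Finset.sum_insert (by simp)]
  ring

/-- The nonincreasing nonnegative diagonal in a singular value decomposition is unique. -/
theorem diagonal_unique_of_map_eq_smul {n : ℕ} {T : E →ₗ[ℝ] F}
    (b b' : OrthonormalBasis (Fin n) ℝ E) {a a' : Fin n → F} (ha : Orthonormal ℝ a)
    (ha' : Orthonormal ℝ a') {s s' : Fin n → ℝ} (hs : ∀ i, 0 ≤ s i) (hs' : ∀ i, 0 ≤ s' i)
    (hanti : Antitone s) (hanti' : Antitone s') (hT : ∀ j, T (b j) = s j • a j)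
    (hT' : ∀ j, T (b' j) = s' j • a' j) : s = s' := by
  have key : ∀ S : Finset (Fin n), (∀ i ∈ S, ∀ j ∉ S, s j ≤ s i) →
      (∀ i ∈ S, ∀ j ∉ S, s' j ≤ s' i) → ∑ i ∈ S, s i = ∑ i ∈ S, s' i := by
    intro S h h'
    refine le_antisymm ?_ ?_
    · rw [← sum_inner_map_eq_of_map_eq_smul ha hT]
      exact sum_inner_map_le_of_map_eq_smul b' ha' hs' hT' h' ha b.orthonormal
    · rw [← sum_inner_map_eq_of_map_eq_smul ha' hT']
      exact sum_inner_map_le_of_map_eq_smul b ha hs hT h ha' b'.orthonormal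
  funext k
  rw [eq_sum_Iic_sub_sum_Iio s, eq_sum_Iic_sub_sum_Iio s',
    key _ (hanti.le_of_mem_Iic_of_notMem k) (hanti'.le_of_mem_Iic_of_notMem k),
    key _ (hanti.le_of_mem_Iio_of_notMem k) (hanti'.le_of_mem_Iio_of_notMem k)]

variable [FiniteDimensional ℝ E] [FiniteDimensional ℝ F]

/-- Singular value decomposition of a linear map whose domain has dimension at most that of its
codomain. -/
theorem LinearMap.exists_singularValue_decomposition {n : ℕ} (T : E →ₗ[ℝ] F)
    (hE : Module.finrank ℝ E = n) (hF : n ≤ Module.finrank ℝ F) :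
    ∃ (b : OrthonormalBasis (Fin n) ℝ E) (a : Fin n → F), Orthonormal ℝ a ∧
      ∀ j : Fin n, T (b j) = T.singularValues j • a j := by
  set b := T.isSymmetric_adjoint_comp_self.eigenvectorBasis hE with hb
  have hinner : ∀ i j : Fin n, inner ℝ (T (b i)) (T (b j)) =
      if i = j then T.singularValues j ^ 2 else 0 := by
    intro i j
    rw [← LinearMap.adjoint_inner_right, ← LinearMap.comp_apply, hb,
      LinearMap.IsSymmetric.apply_eigenvectorBasis, real_inner_smul_right, ← hb,
      orthonormal_iff_ite.1 b.orthonormal i j, T.sq_singularValues_fin hE]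
    simp
  -- The normalised images are orthonormal where the singular value is nonzero, and extend from
  -- there to a basis of `F`. Where it vanishes, `T (b j) = 0` and any completing vector serves.
  set v : Fin (Module.finrank ℝ F) → F := fun i =>
    if h : (i : ℕ) < n then (T.singularValues i)⁻¹ • T (b ⟨i, h⟩) else 0
  set s : Set (Fin (Module.finrank ℝ F)) := {i | (i : ℕ) < n ∧ T.singularValues i ≠ 0}
  have hv : Orthonormal ℝ (s.domRestrict v) := by
    classical
    rw [orthonormal_iff_ite]
    rintro ⟨i, hi, hi0⟩ ⟨j, hj, hj0⟩
    simp only [Set.domRestrict_apply, v, dif_pos hi, dif_pos hj, real_inner_smul_left,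
      real_inner_smul_right, hinner, Subtype.mk.injEq, Fin.ext_iff]
    split_ifs with h
    · rw [h] at *
      field_simp
    · simp
  obtain ⟨c, hc⟩ := hv.exists_orthonormalBasis_extension_of_card_eq (by simp)
  refine ⟨b, fun j => c (Fin.castLE hF j), c.orthonormal.comp _ (Fin.castLE_injective hF),
    fun j => ?_⟩
  by_cases h0 : T.singularValues j = 0
  · have := hinner j j
    rw [if_pos rfl, h0] at this
    rw [h0, zero_smul]
    simpa using this
  · have hj : Fin.castLE hF j ∈ s := ⟨j.2, h0⟩
    simp only [hc _ hj, v, Fin.val_castLE, j.2, dite_true, smul_smul]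
    rw [mul_inv_cancel₀ h0, one_smul]

/-- The diagonal of a singular value decomposition consists of the singular values. -/
theorem LinearMap.eq_singularValues_of_map_eq_smul {n : ℕ} {T : E →ₗ[ℝ] F}
    (hF : n ≤ Module.finrank ℝ F) (b : OrthonormalBasis (Fin n) ℝ E) {a : Fin n → F}
    (ha : Orthonormal ℝ a) {s : Fin n → ℝ} (hs : ∀ i, 0 ≤ s i) (hanti : Antitone s)
    (hT : ∀ j, T (b j) = s j • a j) : s = fun j : Fin n => T.singularValues j := by
  obtain ⟨b', a', ha', hT'⟩ := T.exists_singularValue_decomposition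
    (by simpa using Module.finrank_eq_card_basis b.toBasis) hF
  exact diagonal_unique_of_map_eq_smul b b' ha ha' hs (fun _ => T.singularValues_nonneg _) hanti
    (fun i j hij => T.singularValues_antitone hij) hT hT'

/-- The sum of the singular values over an initial segment of indices is a convex function. -/
theorem convexOn_sum_singularValues {n : ℕ} (hE : Module.finrank ℝ E = n)
    (hF : n ≤ Module.finrank ℝ F) {S : Finset (Fin n)}
    (hS : ∀ s : Fin n → ℝ, Antitone s → ∀ i ∈ S, ∀ j ∉ S, s j ≤ s i) :
    ConvexOn ℝ Set.univ fun T : E →ₗ[ℝ] F => ∑ i ∈ S, T.singularValues i := by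
  refine ⟨convex_univ, fun T₁ _ T₂ _ α β hα hβ _ => ?_⟩
  have bound : ∀ (T : E →ₗ[ℝ] F) {u : Fin n → F} {v : Fin n → E}, Orthonormal ℝ u →
      Orthonormal ℝ v → ∑ i ∈ S, inner ℝ (u i) (T (v i)) ≤ ∑ i ∈ S, T.singularValues i := by
    intro T u v hu hv
    obtain ⟨b, a, ha, hT⟩ := T.exists_singularValue_decomposition hE hF
    exact sum_inner_map_le_of_map_eq_smul b ha (fun _ => T.singularValues_nonneg _) hT
      (hS _ fun i j hij => T.singularValues_antitone hij) hu hv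
  -- The frames of the combination attain its sum; the expression is linear in the map, and `bound`
  -- applies to each summand.
  obtain ⟨b, a, ha, hT⟩ := (α • T₁ + β • T₂).exists_singularValue_decomposition hE hF
  have h := sum_inner_map_eq_of_map_eq_smul ha hT S
  simp only [LinearMap.add_apply, LinearMap.smul_apply, inner_add_right, real_inner_smul_right,
    Finset.sum_add_distrib, ← Finset.mul_sum] at h
  simp only [← h, smul_eq_mul]
  exact add_le_add (mul_le_mul_of_nonneg_left (bound T₁ ha b.orthonormal) hα)
    (mul_le_mul_of_nonneg_left (bound T₂ ha b.orthonormal) hβ)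

end KyFan

/-! ### Hadamard directional derivatives of convex functions -/

section Hadamard

variable {E : Type*} [NormedAddCommGroup E] [NormedSpace ℝ E] [FiniteDimensional ℝ E]

/-- A finite convex function on a finite-dimensional space has directional derivatives, even in
the sense of Hadamard (with varying directions). -/
theorem ConvexOn.exists_tendsto_hadamard {f : E → ℝ} (hf : ConvexOn ℝ Set.univ f) (x w : E) :
    ∃ d : ℝ, Tendsto (fun p : ℝ × E => p.1⁻¹ • (f (x + p.1 • p.2) - f x))
      (𝓝[>] 0 ×ˢ 𝓝 w) (𝓝 d) := by
  have hline : ConvexOn ℝ Set.univ fun t : ℝ => f (x + t • w) := by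
    have := hf.comp_affineMap (AffineMap.lineMap x (x + w))
    simpa [Function.comp_def, AffineMap.lineMap_apply, add_comm] using this
  have hderiv := (hline.hasDerivWithinAt_rightDeriv_of_mem_interior (x := 0) (by simp))
  set d := derivWithin (fun t : ℝ => f (x + t • w)) (Set.Ioi 0) 0
  rw [hasDerivWithinAt_iff_tendsto_slope' (by simp)] at hderiv
  refine ⟨d, ?_⟩
  -- Replacing the varying direction by `w` costs at most `K * ‖p.2 - w‖` in the quotient.
  obtain ⟨K, s, hs, hK⟩ := hf.locallyLipschitz x
  have h1 : Tendsto (fun p : ℝ × E => p.1⁻¹ • (f (x + p.1 • w) - f x))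
      (𝓝[>] 0 ×ˢ 𝓝 w) (𝓝 d) := by
    refine Tendsto.comp (g := fun t : ℝ => t⁻¹ • (f (x + t • w) - f x)) ?_ tendsto_fst
    refine hderiv.congr fun t => ?_
    simp [slope_def_module]
  have h2 : Tendsto (fun p : ℝ × E => p.1⁻¹ • (f (x + p.1 • p.2) - f (x + p.1 • w)))
      (𝓝[>] 0 ×ˢ 𝓝 w) (𝓝 0) := by
    have hle : (𝓝[>] (0 : ℝ) ×ˢ 𝓝 w) ≤ 𝓝 ((0 : ℝ), w) := by
      rw [nhds_prod_eq]
      exact prod_mono nhdsWithin_le_nhds le_rfl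
    have hbound : Tendsto (fun p : ℝ × E => (K : ℝ) * ‖p.2 - w‖) (𝓝[>] 0 ×ˢ 𝓝 w) (𝓝 0) := by
      have : Continuous fun p : ℝ × E => (K : ℝ) * ‖p.2 - w‖ := by fun_prop
      simpa using (this.tendsto ((0 : ℝ), w)).mono_left hle
    have hs1 : ∀ᶠ p : ℝ × E in 𝓝[>] 0 ×ˢ 𝓝 w, x + p.1 • p.2 ∈ s := by
      have : Continuous fun p : ℝ × E => x + p.1 • p.2 := by fun_prop
      exact ((this.tendsto ((0 : ℝ), w)).mono_left hle) (by simpa using hs)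
    have hs2 : ∀ᶠ p : ℝ × E in 𝓝[>] 0 ×ˢ 𝓝 w, x + p.1 • w ∈ s := by
      have : Continuous fun p : ℝ × E => x + p.1 • w := by fun_prop
      exact ((this.tendsto ((0 : ℝ), w)).mono_left hle) (by simpa using hs)
    have hpos : ∀ᶠ p : ℝ × E in 𝓝[>] 0 ×ˢ 𝓝 w, 0 < p.1 :=
      tendsto_fst.eventually self_mem_nhdsWithin
    refine squeeze_zero_norm' ?_ hbound
    filter_upwards [hs1, hs2, hpos] with p hp1 hp2 hp
    have := hK.dist_le_mul _ hp1 _ hp2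
    rw [dist_eq_norm, dist_eq_norm, add_sub_add_left_eq_sub, ← smul_sub, norm_smul,
      Real.norm_of_nonneg hp.le] at this
    rw [norm_smul, norm_inv, Real.norm_of_nonneg hp.le, inv_mul_le_iff₀ hp]
    linarith
  simpa only [← smul_add, sub_add_sub_cancel, zero_add] using h2.add h1

end Hadamard

/-! ### Singular values of matrices and prescribed diagonals -/

section Matrix

variable {m n : ℕ}

/-- The singular values are Hadamard directionally differentiable. -/
theorem exists_tendsto_hadamard_singularValueVector (hnm : n ≤ m)
    (X H : Matrix (Fin m) (Fin n) ℝ) :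
    ∃ d : EuclideanSpace ℝ (Fin n), Tendsto
      (fun p : ℝ × Matrix (Fin m) (Fin n) ℝ =>
        p.1⁻¹ • (singularValueVector (X + p.1 • p.2) - singularValueVector X))
      (𝓝[>] 0 ×ˢ 𝓝 H) (𝓝 d) := by
  let _ : NormedAddCommGroup (Matrix (Fin m) (Fin n) ℝ) := Matrix.normedAddCommGroup
  let _ : NormedSpace ℝ (Matrix (Fin m) (Fin n) ℝ) := Matrix.normedSpace
  have hconv : ∀ S : Finset (Fin n),
      (∀ s : Fin n → ℝ, Antitone s → ∀ i ∈ S, ∀ j ∉ S, s j ≤ s i) →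
      ConvexOn ℝ Set.univ fun A : Matrix (Fin m) (Fin n) ℝ =>
        ∑ i ∈ S, (Matrix.toEuclideanLin A).singularValues i := fun S hS =>
    (convexOn_sum_singularValues (E := EuclideanSpace ℝ (Fin n)) (F := EuclideanSpace ℝ (Fin m))
      (by simp) (by simpa using hnm) hS).comp_linearMap
      (Matrix.toEuclideanLin (𝕜 := ℝ) (m := Fin m) (n := Fin n)).toLinearMap
  choose d₁ hd₁ using fun k : Fin n =>
    (hconv (Finset.Iic k) fun _ hs => hs.le_of_mem_Iic_of_notMem k).exists_tendsto_hadamard X H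
  choose d₂ hd₂ using fun k : Fin n =>
    (hconv (Finset.Iio k) fun _ hs => hs.le_of_mem_Iio_of_notMem k).exists_tendsto_hadamard X H
  refine ⟨WithLp.toLp 2 fun k => d₁ k - d₂ k, ?_⟩
  have hpi : Tendsto (fun p : ℝ × Matrix (Fin m) (Fin n) ℝ => fun k : Fin n =>
      p.1⁻¹ • ((Matrix.toEuclideanLin (X + p.1 • p.2)).singularValues k -
        (Matrix.toEuclideanLin X).singularValues k))
      (𝓝[>] 0 ×ˢ 𝓝 H) (𝓝 fun k => d₁ k - d₂ k) := by
    refine tendsto_pi_nhds.2 fun k => ((hd₁ k).sub (hd₂ k)).congr fun p => ?_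
    rw [eq_sum_Iic_sub_sum_Iio
        (fun j : Fin n => (Matrix.toEuclideanLin (X + p.1 • p.2)).singularValues j) k,
      eq_sum_Iic_sub_sum_Iio (fun j : Fin n => (Matrix.toEuclideanLin X).singularValues j) k,
      ← smul_sub]
    congr 1
    ring
  exact ((PiLp.continuous_toLp 2 _).tendsto _).comp hpi

/-- If `X (b j) = x j • a j` with `a`, `b` orthonormal, then the vector of singular values of `X`
is the image of `x` under a signed permutation matrix. -/
theorem exists_signedPermutation_eq_singularValueVector (hnm : n ≤ m)
    {X : Matrix (Fin m) (Fin n) ℝ} (b : OrthonormalBasis (Fin n) ℝ (EuclideanSpace ℝ (Fin n)))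
    {a : Fin n → EuclideanSpace ℝ (Fin m)} (ha : Orthonormal ℝ a) {x : EuclideanSpace ℝ (Fin n)}
    (hX : ∀ j, Matrix.toEuclideanLin X (b j) = x j • a j) :
    ∃ Q : Matrix (Fin n) (Fin n) ℝ, IsSignedPermutationMatrix Q ∧
      Matrix.toEuclideanLin Q x = singularValueVector X := by
  set π : Equiv.Perm (Fin n) := Tuple.sort fun j => -|x j|
  have hπ : Antitone fun j => |x (π j)| := by
    have := Tuple.monotone_sort fun j => -|x j|
    intro i j hij
    simpa using this hij
  set ε : Fin n → ℝ := fun j => if x j < 0 then -1 else 1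
  have hε : ∀ j, ε j = 1 ∨ ε j = -1 := fun j => by
    simp only [ε]; split_ifs <;> simp
  have hε0 : ∀ j, ε j ≠ 0 := fun j => by rcases hε j with h | h <;> simp [h]
  have hεx : ∀ j, ε j * x j = |x j| := fun j => by
    simp only [ε]
    split_ifs with h
    · rw [abs_of_neg h]; ring
    · rw [abs_of_nonneg (not_lt.1 h), one_mul]
  have hxε : ∀ j, |x j| * ε j = x j := fun j => by
    rw [← hεx]
    rcases hε j with h | h <;> simp [h]
  refine ⟨Matrix.of fun i j => if j = π i then ε j else 0, ⟨fun i j => ?_, fun i => ?_,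
    fun j => ?_⟩, ?_⟩
  · simp only [Matrix.of_apply]
    split_ifs
    · exact Or.inr (hε j)
    · exact Or.inl rfl
  · exact ⟨π i, by simp [hε0], fun j hj => by simpa [hε0] using hj⟩
  · refine ⟨π.symm j, by simp [hε0], fun i hi => ?_⟩
    have : j = π i := by simpa [hε0] using hi
    simp [this]
  -- Moving the signs into the left frame and sorting by absolute value gives a genuine
  -- decomposition, so uniqueness of the diagonal applies.
  · have ha' : Orthonormal ℝ fun j => ε (π j) • a (π j) := by
      have h := ha.comp _ π.injective
      refine ⟨fun j => ?_, fun i j hij => ?_⟩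
      · rw [norm_smul, ha.1]
        rcases hε (π j) with h | h <;> simp [h]
      · simp only [real_inner_smul_left, real_inner_smul_right]
        rw [ha.2 (π.injective.ne hij)]
        simp
    have := LinearMap.eq_singularValues_of_map_eq_smul (T := Matrix.toEuclideanLin X)
      (by simpa using hnm) (b.reindex π.symm) ha' (fun j => abs_nonneg (x (π j))) hπ
      (fun j => by simp [hX, smul_smul, hxε])
    ext i
    rw [singularValueVector, ← this]
    simp [Matrix.toLpLin_apply, Matrix.mulVec, dotProduct, hεx]

/-- The matrix `∑ l, x l • a l (b l)ᵀ`. -/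
noncomputable def sumSMulVecMulVec (a : Fin n → EuclideanSpace ℝ (Fin m))
    (b : Fin n → EuclideanSpace ℝ (Fin n)) (x : EuclideanSpace ℝ (Fin n)) :
    Matrix (Fin m) (Fin n) ℝ :=
  Matrix.of fun i j => ∑ l, x l * (a l i * b l j)

lemma toEuclideanLin_sumSMulVecMulVec (a : Fin n → EuclideanSpace ℝ (Fin m))
    (b : OrthonormalBasis (Fin n) ℝ (EuclideanSpace ℝ (Fin n))) (x : EuclideanSpace ℝ (Fin n))
    (j : Fin n) : Matrix.toEuclideanLin (sumSMulVecMulVec a b x) (b j) = x j • a j := by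
  ext i
  have h : ∀ l, ∑ k, b l k * b j k = if l = j then 1 else 0 := fun l => by
    rw [← orthonormal_iff_ite.1 b.orthonormal l j]
    simp [PiLp.inner_apply, mul_comm]
  simp only [Matrix.toLpLin_apply, Matrix.mulVec, dotProduct, sumSMulVecMulVec, Matrix.of_apply,
    PiLp.smul_apply, smul_eq_mul, Finset.sum_mul]
  rw [Finset.sum_comm]
  simp only [mul_assoc, ← Finset.mul_sum, h]
  simp

lemma eq_sumSMulVecMulVec {X : Matrix (Fin m) (Fin n) ℝ} {a : Fin n → EuclideanSpace ℝ (Fin m)}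
    (b : OrthonormalBasis (Fin n) ℝ (EuclideanSpace ℝ (Fin n))) {x : EuclideanSpace ℝ (Fin n)}
    (hX : ∀ j, Matrix.toEuclideanLin X (b j) = x j • a j) : X = sumSMulVecMulVec a b x := by
  apply Matrix.toEuclideanLin.injective
  refine b.toBasis.ext fun j => ?_
  simp [hX, toEuclideanLin_sumSMulVecMulVec]

lemma sumSMulVecMulVec_sub (a : Fin n → EuclideanSpace ℝ (Fin m))
    (b : Fin n → EuclideanSpace ℝ (Fin n)) (x y : EuclideanSpace ℝ (Fin n)) :
    sumSMulVecMulVec a b (x - y) = sumSMulVecMulVec a b x - sumSMulVecMulVec a b y := by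
  ext i j
  simp [sumSMulVecMulVec, sub_mul]

lemma sumSMulVecMulVec_smul (a : Fin n → EuclideanSpace ℝ (Fin m))
    (b : Fin n → EuclideanSpace ℝ (Fin n)) (r : ℝ) (x : EuclideanSpace ℝ (Fin n)) :
    sumSMulVecMulVec a b (r • x) = r • sumSMulVecMulVec a b x := by
  ext i j
  simp [sumSMulVecMulVec, mul_assoc, Finset.mul_sum]

lemma abs_sumSMulVecMulVec_apply_le {a : Fin n → EuclideanSpace ℝ (Fin m)}
    {b : Fin n → EuclideanSpace ℝ (Fin n)} (ha : ∀ l, ‖a l‖ = 1) (hb : ∀ l, ‖b l‖ = 1)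
    (x : EuclideanSpace ℝ (Fin n)) (i : Fin m) (j : Fin n) :
    |sumSMulVecMulVec a b x i j| ≤ ∑ l, |x l| := by
  rw [sumSMulVecMulVec, Matrix.of_apply]
  refine (Finset.abs_sum_le_sum_abs (fun l => x l * (a l i * b l j)) _).trans
    (Finset.sum_le_sum fun l _ => ?_)
  have h1 : |a l i| ≤ 1 := ha l ▸ PiLp.norm_apply_le (a l) i
  have h2 : |b l j| ≤ 1 := hb l ▸ PiLp.norm_apply_le (b l) j
  rw [abs_mul, abs_mul]
  exact mul_le_of_le_one_right (abs_nonneg _) (mul_le_one₀ h1 (abs_nonneg _) h2)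

/-- Entries are bounded by `∑ l, |x l|` whatever the unit vectors, so the frames may vary without
converging. -/
lemma tendsto_sumSMulVecMulVec_zero {ι : Type*} {f : Filter ι}
    {a : ι → Fin n → EuclideanSpace ℝ (Fin m)} {b : ι → Fin n → EuclideanSpace ℝ (Fin n)}
    (ha : ∀ k l, ‖a k l‖ = 1) (hb : ∀ k l, ‖b k l‖ = 1) {x : ι → EuclideanSpace ℝ (Fin n)}
    (hx : Tendsto x f (𝓝 0)) :
    Tendsto (fun k => sumSMulVecMulVec (a k) (b k) (x k)) f (𝓝 0) := by
  refine tendsto_pi_nhds.2 fun i => tendsto_pi_nhds.2 fun j => ?_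
  have hcont : Continuous fun y : EuclideanSpace ℝ (Fin n) => ∑ l, |y l| := by fun_prop
  refine squeeze_zero_norm (fun k => abs_sumSMulVecMulVec_apply_le (ha k) (hb k) (x k) i j) ?_
  simpa [Function.comp_def] using (hcont.tendsto 0).comp hx

end Matrix

/-! ### The tangent cone formula -/

theorem mainTheorem11 {m n : ℕ} (hnm : n ≤ m)
    (Γ : Set (Matrix (Fin m) (Fin n) ℝ)) (hΓ : IsOrthogonallyInvariantSet Γ)
    (Δ : Set (EuclideanSpace ℝ (Fin n))) (hΔ : IsAbsolutelySymmetricSet Δ)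
    (hΓΔ : Γ = {X : Matrix (Fin m) (Fin n) ℝ | singularValueVector X ∈ Δ})
    (X : Matrix (Fin m) (Fin n) ℝ) (hX : X ∈ Γ) :
    (∀ H : Matrix (Fin m) (Fin n) ℝ, ∃ d : EuclideanSpace ℝ (Fin n),
      HasDirectionalDeriv singularValueVector X H d) ∧
    bouligandTangentCone Γ X =
      {H : Matrix (Fin m) (Fin n) ℝ |
        directionalDeriv singularValueVector X H ∈
          bouligandTangentCone Δ (singularValueVector X)} := by
  have hdir : ∀ H, Tendsto
      (fun p : ℝ × Matrix (Fin m) (Fin n) ℝ =>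
        p.1⁻¹ • (singularValueVector (X + p.1 • p.2) - singularValueVector X))
      (𝓝[>] 0 ×ˢ 𝓝 H) (𝓝 (directionalDeriv singularValueVector X H)) ∧
      HasDirectionalDeriv singularValueVector X H (directionalDeriv singularValueVector X H) := by
    intro H
    obtain ⟨d, hd⟩ := exists_tendsto_hadamard_singularValueVector hnm X H
    have h : HasDirectionalDeriv singularValueVector X H d :=
      hd.comp (tendsto_id.prodMk tendsto_const_nhds)
    have heq : directionalDeriv singularValueVector X H = d := h.limUnder_eq
    rw [heq]
    exact ⟨hd, h⟩
  refine ⟨fun H => ⟨_, (hdir H).2⟩, Set.Subset.antisymm ?_ ?_⟩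
  · rintro H ⟨t, v, ht, ht0, hv, hmem⟩
    have htt : Tendsto t atTop (𝓝[>] 0) :=
      tendsto_nhdsWithin_iff.2 ⟨ht0, Eventually.of_forall ht⟩
    -- The witnesses are the difference quotients along `v k`, so the points reached are the
    -- singular value vectors of `X + t k • v k`.
    refine ⟨t, _, ht, ht0, (hdir H).1.comp (htt.prodMk hv), fun k => ?_⟩
    have := hmem k
    rw [hΓΔ] at this
    simpa [smul_smul, (ht k).ne'] using this
  · rintro H ⟨t, v, ht, ht0, hv, hmem⟩
    have htt : Tendsto t atTop (𝓝[>] 0) :=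
      tendsto_nhdsWithin_iff.2 ⟨ht0, Eventually.of_forall ht⟩
    choose b a ha hsvd using fun k =>
      (Matrix.toEuclideanLin (X + t k • H)).exists_singularValue_decomposition
        (n := n) (by simp) (by simpa using hnm)
    have hrep : ∀ k, X + t k • H =
        sumSMulVecMulVec (a k) (b k) (singularValueVector (X + t k • H)) :=
      fun k => eq_sumSMulVecMulVec (b k) (hsvd k)
    set Y : ℕ → Matrix (Fin m) (Fin n) ℝ := fun k =>
      sumSMulVecMulVec (a k) (b k) (singularValueVector X + t k • v k) with hY
    have hYmem : ∀ k, Y k ∈ Γ := by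
      intro k
      obtain ⟨Q, hQ, hQx⟩ := exists_signedPermutation_eq_singularValueVector hnm (b k) (ha k)
        (toEuclideanLin_sumSMulVecMulVec (a k) (b k) (singularValueVector X + t k • v k))
      rw [hΓΔ, Set.mem_ofPred_eq, hY, ← hQx]
      exact (hΔ Q hQ _).2 (hmem k)
    -- These directions are chosen so that step `t k` from `X` lands exactly on `Y k`.
    refine ⟨t, fun k => H + (t k)⁻¹ • (Y k - (X + t k • H)), ht, ht0, ?_, fun k => ?_⟩
    · have hx : Tendsto (fun k => (t k)⁻¹ • ((singularValueVector X + t k • v k) -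
          singularValueVector (X + t k • H))) atTop (𝓝 0) := by
        have h := hv.sub ((hdir H).2.comp htt)
        rw [sub_self] at h
        refine h.congr fun k => ?_
        simp only [Function.comp_apply]
        rw [smul_sub, smul_sub, smul_add, smul_smul, inv_mul_cancel₀ (ht k).ne', one_smul]
        abel
      have h := (tendsto_sumSMulVecMulVec_zero (fun k => (ha k).1)
        (fun k => (b k).orthonormal.1) hx).const_add H
      rw [add_zero] at h
      refine h.congr fun k => ?_
      rw [sumSMulVecMulVec_smul, sumSMulVecMulVec_sub, ← hrep]
    · have : X + t k • (H + (t k)⁻¹ • (Y k - (X + t k • H))) = Y k := by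
        rw [smul_add, smul_smul, mul_inv_cancel₀ (ht k).ne', one_smul]
        abel
      rw [this]
      exact hYmem k
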